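/- Let $N\ge 2$ and let $H:[0,1]\to\mathbb{C}^{N\times N}$ be a twice-differentiable Hermitian Hamiltonian with bounded second derivative, having for every $s\in[0,1]$ exactly two distinct energy levels: a non-degenerate level $E_G(s)$ and an $(N-1)$-fold degenerate level $E_1(s)\neq E_G(s)$. Let $|\nu(s)\rangle$, $\nu\in\{0,\dots,N-1\}$ (one of the labels being $G$), be an orthonormal basis of instantaneous eigenvectors of $H(s)$ with eigenvalues $E_\nu(s)$ (so $E_\nu=E_1$ for $\nu\ne G$), depending differentiably on $s$ and chosen such that $\langle\dot\nu(s)|\mu(s)\rangle=0$ whenever $E_\nu\equiv E_\mu$ (in particular for $\nu=\mu$), and put $\beta_{\nu,\mu}(s)=\langle\dot\nu(s)|\mu(s)\rangle$. For $T>0$ let $U(s,0)$ be the time-evolution operator: $i\,\partial_sU(s,0)=T\,H(s)\,U(s,0)$, $U(0,0)=1$. The adiabatic error is $(1-P_G(1))\,U(1,0)|G(0)\rangle$, where $P_G(1)=|G(1)\rangle\langle G(1)|$. For $q\ge 0$ let $$C_q=\sum_{\nu_1,\dots,\nu_q}\int_0^1\!\!\int_0^{s_q}\!\!\cdots\int_0^{s_2}\Big(\prod_{k=1}^{q}\beta_{\nu_k,\nu_{k-1}}(s_k)\Big)e^{-iT\sum_{k=0}^{q}\int_{s_k}^{s_{k+1}}E_{\nu_k}(\xi)\,d\xi}\,ds_1\cdots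 ds_q\;|\nu_q(1)\rangle$$ (with $\nu_0=G$, $s_0=0$, $s_{q+1}=1$, and the sum over all labels with $\nu_k\ne\nu_{k-1}$ for $1\le k\le q$ and $\nu_q\neq G$) be the contribution of the non-adiabatic $q$-jump paths to this error; in particular $$C_1=\sum_{\nu\ne G}\int_0^1e^{-iT\left(\int_{s}^1E_\nu(\xi)d\xi+\int_0^{s}E_G(\xi)d\xi\right)}\beta_{\nu,G}(s)\,ds\;|\nu(1)\rangle .$$ Let $\|\dot H\|=\max_{s}\|\dot H(s)\|$ and $\|\ddot H\|=\sup_{s}\|\ddot H(s)\|$ (operator norms, $s\in[0,1]$), $\gamma_{\min}=\min_{s\in[0,1]}|E_G(s)-E_1(s)|$, and $$\Gamma=\frac{6\|\dot H\|^3}{\gamma_{\min}^3}+\frac{\|\dot H\|\,\|\ddot H\|}{\gamma_{\min}^2}+\frac{2\|\dot H\|^2}{\gamma_{\min}^2}.$$ Then paths with an even number of jumps do not contribute to the error, i.e. $C_{2m}=0$ for all $m\ge0$, and $$\Big\|(1-P_G(1))U(1,0)|G(0)\rangle-C_1\Big\|\le\frac{\Gamma}{\|\dot H\|\,T}\left(e^{\Gamma/(\gamma_{\min}T)}-1\right),$$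 where the right-hand side is read as $0$ if $\|\dot H\|=0$. -/

import Mathlib

open Set

namespace Adiabatic

noncomputable section

/-- The Hilbert space `ℂ^N`. -/
abbrev Ket (N : ℕ) : Type := EuclideanSpace ℂ (Fin N)

/-- Operators on `ℂ^N` (complex `N × N` matrices) with the operator norm. -/
abbrev Op (N : ℕ) : Type := Ket N →L[ℂ] Ket N

/-- Derivative with respect to dimensionless time `s ∈ [0,1]` (one-sided at the end points). -/
def dot {F : Type*} [NormedAddCommGroup F] [NormedSpace ℝ F] (f : ℝ → F) : ℝ → F :=
  derivWithin f (Icc 0 1)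

/-- `f` is twice differentiable on `[0,1]`. -/
def TwiceDifferentiable {F : Type*} [NormedAddCommGroup F] [NormedSpace ℝ F]
    (f : ℝ → F) : Prop :=
  DifferentiableOn ℝ f (Icc 0 1) ∧ DifferentiableOn ℝ (dot f) (Icc 0 1)

/-- The maximum (supremum) over `s ∈ [0,1]` of `‖f s‖`. -/
def maxNorm {F : Type*} [NormedAddCommGroup F] (f : ℝ → F) : ℝ :=
  sSup ((fun s => ‖f s‖) '' Icc 0 1)

/-- `U s` is the time-evolution operator `U(s,0)` generated by `H` over a total time `T`:
it solves `i dU/ds = T H(s) U(s)`, `U(0) = 1` on `[0,1]`. -/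
structure IsTimeEvolution {N : ℕ} (H : ℝ → Op N) (T : ℝ) (U : ℝ → Op N) : Prop where
  initial : U 0 = 1
  schrodinger : ∀ s ∈ Icc (0 : ℝ) 1,
    HasDerivWithinAt U ((-(Complex.I * (T : ℂ))) • (H s * U s)) (Icc 0 1) s

/-- `v n s` is an orthonormal basis of instantaneous eigenvectors `|n(s)⟩` of `H(s)`, with
eigenvalues `E n s`, depending differentiably on `s`, and chosen such that `⟨ṅ(s)|m(s)⟩ = 0`
whenever the eigenvalues of `n` and `m` coincide identically (in particular for `n = m`). -/
structure IsEigenframe {N : ℕ} (H : ℝ → Op N) (E : Fin N → ℝ → ℝ)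
    (v : Fin N → ℝ → Ket N) : Prop where
  differentiable : ∀ n, DifferentiableOn ℝ (v n) (Icc 0 1)
  orthonormal : ∀ s ∈ Icc (0 : ℝ) 1, Orthonormal ℂ (fun n => v n s)
  eigen : ∀ s ∈ Icc (0 : ℝ) 1, ∀ n, H s (v n s) = (E n s : ℂ) • v n s
  gauge : ∀ n m, EqOn (E n) (E m) (Icc 0 1) →
    ∀ s ∈ Icc (0 : ℝ) 1, inner ℂ (dot (v n) s) (v m s) = 0

/-- The tunneling amplitude `β_{n,m}(s) = ⟨ṅ(s)|m(s)⟩`. -/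
def beta {N : ℕ} (v : Fin N → ℝ → Ket N) (n m : Fin N) (s : ℝ) : ℂ :=
  inner ℂ (dot (v n) s) (v m s)

/-- The dynamical phase factor `exp(-i T ∫_a^b E_n(ξ) dξ)`. -/
def phase {N : ℕ} (E : Fin N → ℝ → ℝ) (T : ℝ) (n : Fin N) (a b : ℝ) : ℂ :=
  Complex.exp (-(Complex.I * (T : ℂ) * ((∫ ξ in a..b, E n ξ : ℝ) : ℂ)))

/-- The amplitude at time `x` of all paths that visit the states `ν 0, ν 1, …, ν q` in this
order: the integral over all jump times `0 ≤ s₁ ≤ ⋯ ≤ s_q ≤ x` of the product of the tunneling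
amplitudes `β_{ν k, ν (k-1)}(s_k)` and of the dynamical phases picked up between the jumps. -/
def pathAmplitude {N : ℕ} (E : Fin N → ℝ → ℝ) (v : Fin N → ℝ → Ket N) (T : ℝ) :
    (q : ℕ) → (Fin (q + 1) → Fin N) → ℝ → ℂ
  | 0, ν, x => phase E T (ν 0) 0 x
  | q + 1, ν, x =>
      ∫ s in (0 : ℝ)..x,
        phase E T (ν (Fin.last (q + 1))) s x *
          beta v (ν (Fin.last (q + 1))) (ν (Fin.last q).castSucc) s *
          pathAmplitude E v T q (fun i => ν i.castSucc) s

/-- Label sequences of the non-adiabatic `q`-jump paths: they start in `G`, consecutive labels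
differ, and the last label is not `G`. -/
def nonadiabaticPaths {N : ℕ} (G : Fin N) (q : ℕ) : Finset (Fin (q + 1) → Fin N) :=
  {ν | ν 0 = G ∧ (∀ i : Fin q, ν i.succ ≠ ν i.castSucc) ∧ ν (Fin.last q) ≠ G}

/-- `C_q`: the contribution of all non-adiabatic `q`-jump paths to the adiabatic error. -/
def jumpContribution {N : ℕ} (E : Fin N → ℝ → ℝ) (v : Fin N → ℝ → Ket N) (T : ℝ)
    (G : Fin N) (q : ℕ) : Ket N :=
  ∑ ν ∈ nonadiabaticPaths G q, pathAmplitude E v T q ν 1 • v (ν (Fin.last q)) 1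

/-- The adiabatic error `(1 - |G(1)⟩⟨G(1)|) U(1,0) |G(0)⟩`. -/
def adiabaticError {N : ℕ} (U : ℝ → Op N) (v : Fin N → ℝ → Ket N) (G : Fin N) : Ket N :=
  (1 - InnerProductSpace.rankOne ℂ (v G 1) (v G 1) : Op N) (U 1 (v G 0))

/-- `γ_min`: the minimum over `s ∈ [0,1]` of the gap between distinct energies. -/
def minGap {N : ℕ} (E : Fin N → ℝ → ℝ) : ℝ :=
  sInf {g | ∃ s ∈ Icc (0 : ℝ) 1, ∃ n m, E n s ≠ E m s ∧ g = |E n s - E m s|}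

/-- `Γ` as a function of `h₁ = ‖Ḣ‖`, `h₂ = ‖Ḧ‖` and `g = γ_min`. -/
def Gam (h₁ h₂ g : ℝ) : ℝ :=
  (6 * h₁ ^ 3 / g ^ 3 + h₁ * h₂ / g ^ 2) + 2 * h₁ ^ 2 / g ^ 2

end

end Adiabatic

/-! Work in the interaction picture. Let `a` be the amplitude of the evolved state along `G` and `b`
the vector of its excited coordinates, each with its dynamical phase removed. The gauge condition
kills all coupling inside the degenerate level, so `b' = a • B`, where `B` is the tunneling vector
times the phase `e^{iT∫(E_k - E_G)}`, and `‖a'‖ ≤ κ‖b‖` with `κ = ‖Ḣ‖/γ`. Replacing `a` by `1` turns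
`b` into `∫ B`, which is `C₁` up to unimodular phases. Hence it is enough to bound `d = b - ∫ B`,
and the series over paths is never summed.

Since `B` oscillates, `A = B / (iT(E_k - E_G))` satisfies `A' = B + R` with `‖A‖ ≤ p` and `‖R‖ ≤ r`,
both of order `1/T`. One integration by parts and Grönwall give `‖b‖ ≤ (2p + r)e^{κp}`, hence `a -
1` is of order `1/T`; a second integration by parts gives `‖d‖ ≤ κ(2p + r)²e^{κp}`
(`norm_second_order_le`). As `Γ/(‖Ḣ‖T) = 2p + r` and `Γ/(γT) = κ(2p + r)`, the inequality `x e^{x/2}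
≤ e^x - 1` yields the stated form (`second_order_le_gam`).

Even jump numbers drop out by parity: only paths alternating between `G` and excited labels have
nonzero amplitude, and after an even number of jumps these are back at `G`. -/

namespace Adiabatic

/-- Fundamental theorem of calculus on `[0,1]`, with one-sided derivatives at the end points. -/
theorem hasDerivWithinAt_integral {F : Type*} [NormedAddCommGroup F] [NormedSpace ℝ F]
    [CompleteSpace F] {f : ℝ → F} (hf : ContinuousOn f (Icc 0 1)) {s : ℝ}
    (hs : s ∈ Icc (0 : ℝ) 1) :
    HasDerivWithinAt (fun x => ∫ ξ in (0 : ℝ)..x, f ξ) (f s) (Icc 0 1) s := by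
  -- Extending `f` by its endpoint values gives a continuous function on the line, so the two-sided
  -- theorem applies.
  have hg : Continuous (IccExtend zero_le_one ((Icc (0 : ℝ) 1).domRestrict f)) :=
    hf.domRestrict.Icc_extend'
  have heq : EqOn (IccExtend zero_le_one ((Icc (0 : ℝ) 1).domRestrict f)) f (Icc 0 1) :=
    fun x hx => IccExtend_of_mem _ _ hx
  have hd := (hg.integral_hasStrictDerivAt 0 s).hasDerivAt.hasDerivWithinAt (s := Icc 0 1)
  rw [heq hs] at hd
  refine hd.congr_of_mem (fun x hx => ?_) hs
  refine intervalIntegral.integral_congr fun y hy => (heq ?_).symm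
  rw [uIcc_of_le hx.1] at hy
  exact ⟨hy.1, hy.2.trans hx.2⟩

theorem norm_le_of_hasDerivWithinAt {F : Type*} [NormedAddCommGroup F] [NormedSpace ℝ F]
    {f f' : ℝ → F} {C : ℝ} (hf : ∀ s ∈ Icc (0 : ℝ) 1, HasDerivWithinAt f (f' s) (Icc 0 1) s)
    (hC : ∀ s ∈ Icc (0 : ℝ) 1, ‖f' s‖ ≤ C) (h0 : f 0 = 0) {s : ℝ} (hs : s ∈ Icc (0 : ℝ) 1) :
    ‖f s‖ ≤ C := by
  have h := (convex_Icc (0 : ℝ) 1).norm_image_sub_le_of_norm_hasDerivWithin_le hf hC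
    (left_mem_Icc.2 zero_le_one) hs
  have hC0 : 0 ≤ C := (norm_nonneg _).trans (hC s hs)
  rw [h0, sub_zero, sub_zero, Real.norm_of_nonneg hs.1] at h
  nlinarith [hs.2]

/-- The Grönwall bound equals `(e + K c)(e^{Kx} - 1)/K`: its `c` part combines with the offset `c`
into `c e^{Kx}`, and its `e` part is controlled by `(e^K - 1)/K ≤ e^K`. Used with `K = κp`, `e = r`,
`c = 2p`. -/
theorem gronwallBound_zero_add_le {K e c x : ℝ} (hK : 0 ≤ K) (he : 0 ≤ e)
    (hx1 : x ≤ 1) (hc : 0 ≤ c) :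
    c + gronwallBound 0 K (e + K * c) x ≤ (c + e) * Real.exp K := by
  have h1 : Real.exp (K * x) ≤ Real.exp K := Real.exp_le_exp.2 (by nlinarith)
  have h2 : Real.exp K - 1 ≤ K * Real.exp K := by
    have h := Real.add_one_le_exp (-K)
    have h3 : Real.exp (-K) * Real.exp K = 1 := by rw [← Real.exp_add]; simp
    nlinarith [Real.exp_pos K]
  rcases hK.eq_or_lt with rfl | hK
  · rw [gronwallBound_K0]; simp; nlinarith
  · rw [gronwallBound_of_K_ne_0 hK.ne']
    have h3 : (e + K * c) / K * (Real.exp (K * x) - 1) ≤ (e + K * c) / K * (Real.exp K - 1) := by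
      gcongr
    have h4 : (e + K * c) / K * (Real.exp K - 1)
        = e * ((Real.exp K - 1) / K) + c * (Real.exp K - 1) := by field_simp
    have h5 : (Real.exp K - 1) / K ≤ Real.exp K := by
      rw [div_le_iff₀ hK]; linarith
    nlinarith [mul_le_mul_of_nonneg_left h5 he]

/-- Adiabatic elimination: if the coupling `B` of `a' = O(κ ‖b‖)`, `b' = a B` has an approximate
primitive `A` of size `p` up to an error of size `r`, then `b` deviates from its first-order
approximation by a quantity of second order. -/
theorem norm_second_order_le {W : Type*} [NormedAddCommGroup W] [NormedSpace ℂ W]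
    {a α : ℝ → ℂ} {b d A B R : ℝ → W} {κ p r : ℝ} (hκ : 0 ≤ κ)
    (ha : ∀ s ∈ Icc (0 : ℝ) 1, HasDerivWithinAt a (α s) (Icc 0 1) s)
    (hb : ∀ s ∈ Icc (0 : ℝ) 1, HasDerivWithinAt b (a s • B s) (Icc 0 1) s)
    (hd : ∀ s ∈ Icc (0 : ℝ) 1, HasDerivWithinAt d ((a s - 1) • B s) (Icc 0 1) s)
    (hA : ∀ s ∈ Icc (0 : ℝ) 1, HasDerivWithinAt A (B s + R s) (Icc 0 1) s)
    (hα : ∀ s ∈ Icc (0 : ℝ) 1, ‖α s‖ ≤ κ * ‖b s‖)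
    (hp : ∀ s ∈ Icc (0 : ℝ) 1, ‖A s‖ ≤ p)
    (hr : ∀ s ∈ Icc (0 : ℝ) 1, ‖R s‖ ≤ r)
    (ha1 : ∀ s ∈ Icc (0 : ℝ) 1, ‖a s‖ ≤ 1)
    (ha0 : a 0 = 1) (hb0 : b 0 = 0) (hd0 : d 0 = 0) :
    ‖d 1‖ ≤ κ * ((2 * p + r) * Real.exp (κ * p)) * (2 * p + r) := by
  have h0 : (0 : ℝ) ∈ Icc (0 : ℝ) 1 := left_mem_Icc.2 zero_le_one
  have hp0 : 0 ≤ p := (norm_nonneg _).trans (hp 0 h0)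
  have hr0 : 0 ≤ r := (norm_nonneg _).trans (hr 0 h0)
  set M := (2 * p + r) * Real.exp (κ * p) with hM
  have hM0 : 0 ≤ M := by positivity
  -- First integration by parts: subtracting `a • A` cancels the oscillating term `a • B`, and `A 0`
  -- makes the initial value zero.
  have hz : ∀ s ∈ Icc (0 : ℝ) 1, HasDerivWithinAt (fun s => b s - a s • A s + A 0)
      (-(a s • R s + α s • A s)) (Icc 0 1) s := fun s hs => by
    refine (((hb s hs).sub ((ha s hs).smul (hA s hs))).add_const _).congr_deriv ?_
    rw [smul_add]; abel
  have hbz : ∀ s ∈ Icc (0 : ℝ) 1, ‖b s‖ ≤ ‖b s - a s • A s + A 0‖ + 2 * p := fun s hs => by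
    have h1 : ‖a s • A s‖ ≤ p := by
      rw [norm_smul]
      nlinarith [ha1 s hs, hp s hs, norm_nonneg (a s), norm_nonneg (A s)]
    calc ‖b s‖ = ‖(b s - a s • A s + A 0) + (a s • A s - A 0)‖ := by congr 1; abel
      _ ≤ _ := (norm_add_le _ _).trans (by linarith [norm_sub_le (a s • A s) (A 0), hp 0 h0])
  have hbM : ∀ s ∈ Icc (0 : ℝ) 1, ‖b s‖ ≤ M := fun s hs => by
    -- The term `α • A` is at most `κ(‖z‖ + 2p)p`, with `z` the function `f` below; this gives the
    -- rate `κp` and the inhomogeneity `r + κp · 2p`.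
    have hg := norm_le_gronwallBound_of_norm_deriv_right_le
      (f := fun s => b s - a s • A s + A 0) (δ := 0) (K := κ * p) (ε := r + κ * p * (2 * p))
      (a := 0) (b := 1) (fun s hs => (hz s hs).continuousWithinAt)
      (fun s hs => (hz s ⟨hs.1, hs.2.le⟩).mono_of_mem_nhdsWithin (Icc_mem_nhdsGE_of_mem hs))
      (by simp [hb0, ha0]) (fun s hs => by
        have hs' : s ∈ Icc (0 : ℝ) 1 := ⟨hs.1, hs.2.le⟩
        rw [norm_neg]
        refine (norm_add_le _ _).trans ?_
        rw [norm_smul, norm_smul]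
        have e1 : ‖a s‖ * ‖R s‖ ≤ 1 * r :=
          mul_le_mul (ha1 s hs') (hr s hs') (norm_nonneg _) zero_le_one
        have e2 : ‖α s‖ * ‖A s‖ ≤ (κ * (‖b s - a s • A s + A 0‖ + 2 * p)) * p :=
          mul_le_mul ((hα s hs').trans (by gcongr; exact hbz s hs')) (hp s hs')
            (norm_nonneg _) (by positivity)
        linarith) s hs
    rw [sub_zero] at hg
    have h2 := gronwallBound_zero_add_le (K := κ * p) (e := r) (c := 2 * p) (by positivity) hr0
      hs.2 (by positivity)
    linarith [hbz s hs]
  have hαM : ∀ s ∈ Icc (0 : ℝ) 1, ‖α s‖ ≤ κ * M := fun s hs =>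
    (hα s hs).trans (by gcongr; exact hbM s hs)
  have haM : ∀ s ∈ Icc (0 : ℝ) 1, ‖a s - 1‖ ≤ κ * M := fun s hs =>
    norm_le_of_hasDerivWithinAt (f := fun s => a s - 1)
      (fun s hs => (ha s hs).sub_const 1) hαM (by simp [ha0]) hs
  have h1 : (1 : ℝ) ∈ Icc (0 : ℝ) 1 := right_mem_Icc.2 zero_le_one
  -- Second integration by parts: `a - 1` is already small, so the remainder is of second order.
  have hw := norm_le_of_hasDerivWithinAt (f := fun s => d s - (a s - 1) • A s)
    (f' := fun s => -((a s - 1) • R s + α s • A s)) (C := κ * M * r + κ * M * p)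
    (fun s hs => by
      refine ((hd s hs).sub (((ha s hs).sub_const 1).smul (hA s hs))).congr_deriv ?_
      rw [smul_add]; abel)
    (fun s hs => by
      rw [norm_neg]
      refine (norm_add_le _ _).trans ?_
      rw [norm_smul, norm_smul]
      exact add_le_add
        (mul_le_mul (haM s hs) (hr s hs) (norm_nonneg _) (by positivity))
        (mul_le_mul (hαM s hs) (hp s hs) (norm_nonneg _) (by positivity)))
    (by simp [ha0, hd0]) h1
  have h2 : ‖(a 1 - 1) • A 1‖ ≤ κ * M * p := by
    rw [norm_smul]
    exact mul_le_mul (haM 1 h1) (hp 1 h1) (norm_nonneg _) (by positivity)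
  calc ‖d 1‖ = ‖(d 1 - (a 1 - 1) • A 1) + (a 1 - 1) • A 1‖ := by congr 1; abel
    _ ≤ _ := (norm_add_le _ _).trans (by linarith)

/-- After division by `e^{x/2}` this is `x ≤ 2 sinh (x/2)`. -/
theorem mul_exp_half_le {x : ℝ} (hx : 0 ≤ x) : x * Real.exp (x / 2) ≤ Real.exp x - 1 := by
  have h1 : x / 2 ≤ Real.sinh (x / 2) := Real.self_le_sinh_iff.2 (by positivity)
  rw [Real.sinh_eq] at h1
  have h2 : Real.exp x = Real.exp (x / 2) * Real.exp (x / 2) := by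
    rw [← Real.exp_add]; ring_nf
  have h3 : Real.exp (-(x / 2)) * Real.exp (x / 2) = 1 := by rw [← Real.exp_add]; simp
  nlinarith [Real.exp_pos (x / 2)]


theorem hasDerivWithinAt_dot {F : Type*} [NormedAddCommGroup F] [NormedSpace ℝ F] {f : ℝ → F}
    (hf : DifferentiableOn ℝ f (Icc 0 1)) {s : ℝ} (hs : s ∈ Icc (0 : ℝ) 1) :
    HasDerivWithinAt f (dot f s) (Icc 0 1) s :=
  (hf s hs).hasDerivWithinAt

theorem uniqueDiffWithinAt_Icc {s : ℝ} (hs : s ∈ Icc (0 : ℝ) 1) :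
    UniqueDiffWithinAt ℝ (Icc 0 1) s :=
  uniqueDiffOn_Icc zero_lt_one s hs

theorem norm_le_maxNorm {F : Type*} [NormedAddCommGroup F] {f : ℝ → F}
    (hf : BddAbove ((fun s => ‖f s‖) '' Icc 0 1)) {s : ℝ} (hs : s ∈ Icc (0 : ℝ) 1) :
    ‖f s‖ ≤ maxNorm f :=
  le_csSup hf ⟨s, hs, rfl⟩

/-! ### Coordinates in the eigenframe and perturbation theory of a two-level Hamiltonian. -/

variable {N : ℕ}

theorem hasDerivWithinAt_op_apply {A : ℝ → Op N} {x : ℝ → Ket N} {A' : Op N} {x' : Ket N}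
    {t : Set ℝ} {s : ℝ} (hA : HasDerivWithinAt A A' t s) (hx : HasDerivWithinAt x x' t s) :
    HasDerivWithinAt (fun s => A s (x s)) (A' (x s) + A s x') t s :=
  ((ContinuousLinearMap.restrictScalarsL ℂ (Ket N) (Ket N) ℝ ℝ).hasFDerivAt.comp_hasDerivWithinAt
    s hA).clm_apply hx

/-- A Hamiltonian with exactly two energy levels: the non-degenerate one of `G`, and the one of
`k`, shared by all labels other than `G`. -/
structure IsTwoLevel (H : ℝ → Op N) (E : Fin N → ℝ → ℝ) (v : Fin N → ℝ → Ket N)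
    (G k : Fin N) : Prop where
  selfAdjoint : ∀ s ∈ Icc (0 : ℝ) 1, IsSelfAdjoint (H s)
  twiceDiff : TwiceDifferentiable H
  bdd : BddAbove ((fun s => ‖dot (dot H) s‖) '' Icc 0 1)
  frame : IsEigenframe H E v
  degenerate : ∀ n, n ≠ G → EqOn (E n) (E k) (Icc 0 1)
  gap : ∀ s ∈ Icc (0 : ℝ) 1, E k s ≠ E G s

/-- The coordinates of `x` in the frame `v n s`, with the one along `G` removed. -/
noncomputable def excited (v : Fin N → ℝ → Ket N) (G : Fin N) (s : ℝ) (x : Ket N) : Ket N :=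
  WithLp.toLp 2 fun n => if n = G then 0 else inner ℂ (v n s) x

/-- The vector of tunneling amplitudes out of `G`. -/
noncomputable def tunneling (v : Fin N → ℝ → Ket N) (G : Fin N) (s : ℝ) : Ket N :=
  WithLp.toLp 2 fun n => beta v n G s

theorem excited_smul (v : Fin N → ℝ → Ket N) (G : Fin N) (s : ℝ) (c : ℂ) (x : Ket N) :
    excited v G s (c • x) = c • excited v G s x := by
  ext n; simp [excited]

theorem inner_excited (v : Fin N → ℝ → Ket N) (G : Fin N) (s : ℝ) (x y : Ket N) :
    inner ℂ (excited v G s x) (excited v G s y)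
      = ∑ n, if n = G then 0 else inner ℂ x (v n s) * inner ℂ (v n s) y := by
  simp only [excited, PiLp.inner_apply]
  refine Finset.sum_congr rfl fun n _ => ?_
  by_cases h : n = G <;> simp [h, mul_comm]

section
variable {v : Fin N → ℝ → Ket N} {s : ℝ} (hv : Orthonormal ℂ fun n => v n s)
include hv

theorem exists_orthonormalBasis :
    ∃ b : OrthonormalBasis (Fin N) ℂ (Ket N), ∀ n, b n = v n s := by
  refine ⟨OrthonormalBasis.mk hv ?_, fun n => congrFun (OrthonormalBasis.coe_mk hv _) n⟩
  rcases N.eq_zero_or_pos with rfl | hN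
  · exact fun x _ => by rw [Subsingleton.elim x 0]; exact Submodule.zero_mem _
  · have : Nonempty (Fin N) := ⟨⟨0, hN⟩⟩
    have h := (basisOfOrthonormalOfCardEqFinrank hv (by simp)).span_eq
    rw [coe_basisOfOrthonormalOfCardEqFinrank] at h
    exact h.ge

theorem inner_eq_add_inner_excited (G : Fin N) (x y : Ket N) :
    inner ℂ x y = inner ℂ x (v G s) * inner ℂ (v G s) y
      + inner ℂ (excited v G s x) (excited v G s y) := by
  obtain ⟨b, hb⟩ := exists_orthonormalBasis hv
  rw [← b.sum_inner_mul_inner x y, inner_excited, ← Finset.add_sum_erase _ _ (Finset.mem_univ G),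
    ← Finset.add_sum_erase (a := G) (f := fun n => if n = G then 0 else _) _ (Finset.mem_univ G)]
  simp only [hb, if_true, zero_add]
  congr 1
  exact Finset.sum_congr rfl fun n hn => by rw [if_neg (Finset.ne_of_mem_erase hn)]

theorem norm_excited_le (G : Fin N) (x : Ket N) : ‖excited v G s x‖ ≤ ‖x‖ := by
  have h := inner_eq_add_inner_excited hv G x x
  have h2 : inner ℂ x (v G s) * inner ℂ (v G s) x = ((‖inner ℂ (v G s) x‖ ^ 2 : ℝ) : ℂ) := by
    rw [← inner_conj_symm x (v G s), mul_comm, Complex.mul_conj, Complex.normSq_eq_norm_sq]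
  rw [h2, inner_self_eq_norm_sq_to_K, inner_self_eq_norm_sq_to_K] at h
  have h3 : ‖x‖ ^ 2 = ‖inner ℂ (v G s) x‖ ^ 2 + ‖excited v G s x‖ ^ 2 :=
    Complex.ofReal_injective (by push_cast; push_cast at h; exact h)
  exact abs_le_of_sq_le_sq' (by nlinarith [sq_nonneg ‖inner ℂ (v G s) x‖]) (norm_nonneg _) |>.2

end

namespace IsEigenframe

variable {H : ℝ → Op N} {E : Fin N → ℝ → ℝ} {v : Fin N → ℝ → Ket N} (hf : IsEigenframe H E v)
  {s : ℝ} (hs : s ∈ Icc (0 : ℝ) 1)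
include hf hs

theorem hasDerivWithinAt (n : Fin N) : HasDerivWithinAt (v n) (dot (v n) s) (Icc 0 1) s :=
  hasDerivWithinAt_dot (hf.differentiable n) hs

theorem inner_dot_self (n : Fin N) : inner ℂ (dot (v n) s) (v n s) = 0 :=
  hf.gauge n n (fun _ _ => rfl) s hs

theorem inner_dot_add_inner_dot (n m : Fin N) :
    inner ℂ (v n s) (dot (v m) s) + inner ℂ (dot (v n) s) (v m s) = 0 := by
  have h1 := (hf.hasDerivWithinAt hs n).inner ℂ (hf.hasDerivWithinAt hs m)
  have h2 : HasDerivWithinAt (fun t => inner ℂ (v n t) (v m t)) 0 (Icc 0 1) s :=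
    (hasDerivWithinAt_const s _ (if n = m then (1 : ℂ) else 0)).congr
      (fun t ht => orthonormal_iff_ite.1 (hf.orthonormal t ht) n m)
      (orthonormal_iff_ite.1 (hf.orthonormal s hs) n m)
  exact (uniqueDiffWithinAt_Icc hs).eq_deriv _ h1 h2

end IsEigenframe

namespace IsTwoLevel

variable {H : ℝ → Op N} {E : Fin N → ℝ → ℝ} {v : Fin N → ℝ → Ket N} {G k : Fin N}
  (h : IsTwoLevel H E v G k) {s : ℝ} (hs : s ∈ Icc (0 : ℝ) 1)
include h

theorem beta_eq_zero (hs : s ∈ Icc (0 : ℝ) 1) {n m : Fin N} (hn : n ≠ G) (hm : m ≠ G) :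
    beta v n m s = 0 :=
  h.frame.gauge n m ((h.degenerate n hn).trans (h.degenerate m hm).symm) s hs

include hs

theorem inner_apply (x y : Ket N) : inner ℂ x (H s y) = inner ℂ (H s x) y := by
  have := (h.selfAdjoint s hs).isSymmetric
  exact (this x y).symm

theorem inner_frame_apply (n : Fin N) (x : Ket N) :
    inner ℂ (v n s) (H s x) = E n s * inner ℂ (v n s) x := by
  rw [h.inner_apply hs, h.frame.eigen s hs, inner_smul_left, Complex.conj_ofReal]

theorem norm_frame (n : Fin N) : ‖v n s‖ = 1 := (h.frame.orthonormal s hs).1 n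

theorem hasDerivWithinAt_hamiltonian : HasDerivWithinAt H (dot H s) (Icc 0 1) s :=
  hasDerivWithinAt_dot h.twiceDiff.1 hs

theorem norm_dot_le : ‖dot H s‖ ≤ maxNorm (dot H) :=
  norm_le_maxNorm (isCompact_Icc.bddAbove_image h.twiceDiff.2.continuousOn.norm) hs

theorem norm_dot_dot_le : ‖dot (dot H) s‖ ≤ maxNorm (dot (dot H)) :=
  norm_le_maxNorm h.bdd hs

theorem hasDerivWithinAt_matrixElement (n m : Fin N) :
    HasDerivWithinAt (fun t => inner ℂ (v n t) (H t (v m t)))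
      (inner ℂ (v n s) (dot H s (v m s)) + E n s * inner ℂ (v n s) (dot (v m) s)
        + E m s * inner ℂ (dot (v n) s) (v m s)) (Icc 0 1) s := by
  refine ((h.frame.hasDerivWithinAt hs n).inner ℂ (hasDerivWithinAt_op_apply
    (h.hasDerivWithinAt_hamiltonian hs) (h.frame.hasDerivWithinAt hs m))).congr_deriv ?_
  rw [inner_add_right, h.inner_frame_apply hs, h.frame.eigen s hs, inner_smul_right]

/-- Hellmann–Feynman: in the diagonal matrix element of `H` the derivatives of the eigenvectors
cancel. Differentiability of the energies is thus derived, not assumed. -/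
theorem hasDerivWithinAt_energy (n : Fin N) :
    HasDerivWithinAt (E n) (inner ℂ (v n s) (dot H s (v n s))).re (Icc 0 1) s := by
  have h1 := h.hasDerivWithinAt_matrixElement hs n n
  have h2 := h.frame.inner_dot_add_inner_dot hs n n
  have h3 := h.frame.inner_dot_self hs n
  rw [h3, add_zero] at h2
  rw [h2, h3, mul_zero, add_zero, add_zero] at h1
  have h4 := Complex.reCLM.hasFDerivAt.comp_hasDerivWithinAt s h1
  refine h4.congr_of_mem (fun t ht => ?_) hs
  simp [h.inner_frame_apply ht, h.norm_frame ht]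

/-- First-order perturbation theory. -/
theorem inner_dot_hamiltonian {n : Fin N} (hn : n ≠ G) :
    inner ℂ (v n s) (dot H s (v G s)) = (E k s - E G s) * beta v n G s := by
  have h1 := h.hasDerivWithinAt_matrixElement hs n G
  -- The off-diagonal matrix element vanishes identically, hence so does its derivative.
  have h2 : HasDerivWithinAt (fun t => inner ℂ (v n t) (H t (v G t))) 0 (Icc 0 1) s :=
    (hasDerivWithinAt_const s _ (0 : ℂ)).congr_of_mem (fun t ht => by
      rw [h.inner_frame_apply ht, (h.frame.orthonormal t ht).2 hn, mul_zero]) hs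
  have h3 := (uniqueDiffWithinAt_Icc hs).eq_deriv _ h1 h2
  have h4 := h.frame.inner_dot_add_inner_dot hs n G
  rw [h.degenerate n hn hs] at h3
  unfold beta
  linear_combination h3 - E k s * h4

theorem gap_ne_zero : (E k s - E G s : ℂ) ≠ 0 := by
  have := h.gap s hs
  rw [sub_ne_zero]; exact_mod_cast this

theorem excited_dot_hamiltonian :
    excited v G s (dot H s (v G s)) = (E k s - E G s : ℂ) • tunneling v G s := by
  ext n
  by_cases hn : n = G
  · subst hn
    simp [excited, tunneling, beta, h.frame.inner_dot_self hs]
  · simp [excited, tunneling, hn, h.inner_dot_hamiltonian hs hn]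

/-- The frame is only once differentiable, so `β` cannot be differentiated from its definition. The
right-hand side involves no derivative of the frame and can be both differentiated and bounded. -/
theorem tunneling_eq :
    tunneling v G s = (E k s - E G s : ℂ)⁻¹ • excited v G s (dot H s (v G s)) := by
  rw [h.excited_dot_hamiltonian hs, inv_smul_smul₀ (h.gap_ne_zero hs)]

theorem tunneling_eq_neg_excited : tunneling v G s = -excited v G s (dot (v G) s) := by
  ext n
  have h1 := h.frame.inner_dot_add_inner_dot hs n G
  by_cases hn : n = G
  · subst hn
    simp [excited, tunneling, beta, h.frame.inner_dot_self hs]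
  · simp [excited, tunneling, beta, hn]
    linear_combination h1

theorem inner_dot_eq (x : Ket N) :
    inner ℂ (dot (v G) s) x = -inner ℂ (tunneling v G s) (excited v G s x) := by
  rw [inner_eq_add_inner_excited (h.frame.orthonormal s hs) G, h.frame.inner_dot_self hs,
    h.tunneling_eq_neg_excited hs, inner_neg_left]
  ring

/-- The gauge removes the `G` component of the derivative of the ground state, so only the tunneling
amplitudes remain. -/
theorem norm_dot_ground : ‖dot (v G) s‖ = ‖tunneling v G s‖ := by
  have h1 := h.inner_dot_eq hs (dot (v G) s)
  rw [← inner_neg_right, ← h.tunneling_eq_neg_excited hs, inner_self_eq_norm_sq_to_K,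
    inner_self_eq_norm_sq_to_K] at h1
  have h2 : ‖dot (v G) s‖ ^ 2 = ‖tunneling v G s‖ ^ 2 := by exact_mod_cast h1
  exact (sq_eq_sq₀ (norm_nonneg _) (norm_nonneg _)).1 h2

theorem inner_dot_excited {n : Fin N} (hn : n ≠ G) (x : Ket N) :
    inner ℂ (dot (v n) s) x = beta v n G s * inner ℂ (v G s) x := by
  rw [inner_eq_add_inner_excited (h.frame.orthonormal s hs) G, inner_excited,
    Finset.sum_eq_zero, add_zero]
  · rfl
  · intro m _
    split_ifs with hm
    · rfl
    · rw [show inner ℂ (dot (v n) s) (v m s) = 0 from h.beta_eq_zero hs hn hm, zero_mul]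

theorem excited_hamiltonian (x : Ket N) :
    excited v G s (H s x) = (E k s : ℂ) • excited v G s x := by
  ext n
  by_cases hn : n = G
  · simp [excited, hn]
  · simp [excited, hn, h.inner_frame_apply hs, h.degenerate n hn hs]

/-- By the gauge, the derivative of an excited frame vector points along `G` only; moving the frame
therefore adds just the tunneling term. -/
theorem hasDerivWithinAt_excited {x : ℝ → Ket N} {x' : Ket N}
    (hx : HasDerivWithinAt x x' (Icc 0 1) s) :
    HasDerivWithinAt (fun t => excited v G t (x t))
      (inner ℂ (v G s) (x s) • tunneling v G s + excited v G s x') (Icc 0 1) s := by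
  suffices hc : ∀ n, HasDerivWithinAt (fun t => excited v G t (x t) n)
      ((inner ℂ (v G s) (x s) • tunneling v G s + excited v G s x') n) (Icc 0 1) s from
    (hasFDerivWithinAt_piLp 2).2 fun n => (hc n).hasFDerivWithinAt.congr_fderiv (by ext; simp)
  intro n
  by_cases hn : n = G
  · subst hn
    simpa [excited, tunneling, beta, h.frame.inner_dot_self hs] using
      hasDerivWithinAt_const (𝕜 := ℝ) s _ (0 : ℂ)
  · have h1 := (h.frame.hasDerivWithinAt hs n).inner ℂ hx
    rw [h.inner_dot_excited hs hn] at h1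
    simp only [excited, hn, if_false]
    refine h1.congr_deriv ?_
    simp [tunneling, hn]
    ring

end IsTwoLevel

/-! ### Dynamical phases and the constant `Γ`. -/

theorem phase_ne_zero (E : Fin N → ℝ → ℝ) (T : ℝ) (n : Fin N) (a b : ℝ) : phase E T n a b ≠ 0 :=
  Complex.exp_ne_zero _

theorem norm_phase (E : Fin N → ℝ → ℝ) (T : ℝ) (n : Fin N) (a b : ℝ) : ‖phase E T n a b‖ = 1 := by
  rw [phase, show -(Complex.I * (T : ℂ) * ((∫ ξ in a..b, E n ξ : ℝ) : ℂ))
    = ((-(T * ∫ ξ in a..b, E n ξ) : ℝ) : ℂ) * Complex.I by push_cast; ring]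
  exact Complex.norm_exp_ofReal_mul_I _

theorem norm_phase_ratio (E : Fin N → ℝ → ℝ) (T : ℝ) (n m : Fin N) (s : ℝ) :
    ‖(phase E T n 0 s)⁻¹ * phase E T m 0 s‖ = 1 := by
  rw [norm_mul, norm_inv, norm_phase, norm_phase, inv_one, one_mul]

theorem second_order_le_gam {h₁ h₂ γ T : ℝ} (hh₁ : 0 ≤ h₁) (hh₂ : 0 ≤ h₂) (hγ : 0 < γ)
    (hT : 0 < T) :
    h₁ / γ * ((2 * (h₁ / γ / (γ * T)) + (6 * h₁ ^ 2 / γ ^ 3 + h₂ / γ ^ 2) / T)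
        * Real.exp (h₁ / γ * (h₁ / γ / (γ * T))))
        * (2 * (h₁ / γ / (γ * T)) + (6 * h₁ ^ 2 / γ ^ 3 + h₂ / γ ^ 2) / T)
      ≤ Gam h₁ h₂ γ / (h₁ * T) * (Real.exp (Gam h₁ h₂ γ / (γ * T)) - 1) := by
  -- For `h₁ = 0` the left side vanishes, and division by zero makes the right side `0`.
  rcases hh₁.eq_or_lt with rfl | h1
  · simp
  have hx : Gam h₁ h₂ γ / (γ * T)
      = h₁ / γ * (2 * (h₁ / γ / (γ * T)) + (6 * h₁ ^ 2 / γ ^ 3 + h₂ / γ ^ 2) / T) := by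
    rw [Gam]; field_simp; ring
  have hy : Gam h₁ h₂ γ / (h₁ * T)
      = 2 * (h₁ / γ / (γ * T)) + (6 * h₁ ^ 2 / γ ^ 3 + h₂ / γ ^ 2) / T := by
    rw [Gam]; field_simp; ring
  have hκ : 0 ≤ h₁ / γ := by positivity
  have hp : 0 ≤ h₁ / γ / (γ * T) := by positivity
  have hr : 0 ≤ (6 * h₁ ^ 2 / γ ^ 3 + h₂ / γ ^ 2) / T := by positivity
  rw [hx, hy]
  generalize h₁ / γ / (γ * T) = p at *
  generalize (6 * h₁ ^ 2 / γ ^ 3 + h₂ / γ ^ 2) / T = r at *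
  generalize h₁ / γ = κ at *
  have e1 := mul_exp_half_le (x := κ * (2 * p + r)) (by positivity)
  -- Since `r ≥ 0`, `p` is at most half of `2p + r`; this is where the exponent `x/2` comes from.
  have e2 : Real.exp (κ * p) ≤ Real.exp (κ * (2 * p + r) / 2) :=
    Real.exp_le_exp.2 (by nlinarith [mul_nonneg hκ hr])
  calc κ * ((2 * p + r) * Real.exp (κ * p)) * (2 * p + r)
      = (2 * p + r) * (κ * (2 * p + r) * Real.exp (κ * p)) := by ring
    _ ≤ (2 * p + r) * (κ * (2 * p + r) * Real.exp (κ * (2 * p + r) / 2)) := by gcongr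
    _ ≤ _ := by gcongr

/-- The resolvent-weighted amplitude `(iT(E_k - E_G))⁻¹ e^{iT∫(E_k - E_G)} β`, an approximate
primitive of the oscillating tunneling amplitude for large `T`. -/
noncomputable def approxPrimitive (E : Fin N → ℝ → ℝ) (v : Fin N → ℝ → Ket N) (T : ℝ)
    (G k : Fin N) (s : ℝ) : Ket N :=
  ((phase E T k 0 s)⁻¹ * phase E T G 0 s) •
    ((Complex.I * T)⁻¹ • ((E k s - E G s : ℂ)⁻¹ • tunneling v G s))

/-- The vector of tunneling amplitudes out of `G` in the interaction picture. -/
noncomputable def oscillatingTunneling (E : Fin N → ℝ → ℝ) (v : Fin N → ℝ → Ket N) (T : ℝ)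
    (G k : Fin N) (s : ℝ) : Ket N :=
  ((phase E T k 0 s)⁻¹ * phase E T G 0 s) • tunneling v G s

theorem IsTimeEvolution.hasDerivWithinAt_apply {H : ℝ → Op N} {T : ℝ} {U : ℝ → Op N}
    (hU : IsTimeEvolution H T U) {s : ℝ} (hs : s ∈ Icc (0 : ℝ) 1) (x : Ket N) :
    HasDerivWithinAt (fun t => U t x) (-(Complex.I * (T : ℂ)) • H s (U s x)) (Icc 0 1) s := by
  simpa using hasDerivWithinAt_op_apply (hU.schrodinger s hs) (hasDerivWithinAt_const s _ x)

/-! ### Gap estimates and the approximate primitive. -/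

namespace IsTwoLevel

variable {H : ℝ → Op N} {E : Fin N → ℝ → ℝ} {v : Fin N → ℝ → Ket N} {G k : Fin N}
  (h : IsTwoLevel H E v G k)
include h

theorem continuousOn_energy (n : Fin N) : ContinuousOn (E n) (Icc 0 1) := fun _ hs =>
  (h.hasDerivWithinAt_energy hs n).continuousWithinAt

theorem hasDerivWithinAt_phase (T : ℝ) (n : Fin N) {s : ℝ} (hs : s ∈ Icc (0 : ℝ) 1) :
    HasDerivWithinAt (phase E T n 0) (-(Complex.I * T * E n s) * phase E T n 0 s)
      (Icc 0 1) s := by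
  have h1 := (hasDerivWithinAt_integral (h.continuousOn_energy n) hs).ofReal_comp
  refine ((h1.const_mul (Complex.I * T)).fun_neg.cexp).congr_deriv ?_
  simp only [phase]
  ring

theorem hasDerivWithinAt_phase_inv (T : ℝ) (n : Fin N) {s : ℝ} (hs : s ∈ Icc (0 : ℝ) 1) :
    HasDerivWithinAt (fun t => (phase E T n 0 t)⁻¹) (Complex.I * T * E n s * (phase E T n 0 s)⁻¹)
      (Icc 0 1) s := by
  refine ((h.hasDerivWithinAt_phase T n hs).fun_inv (phase_ne_zero E T n 0 s)).congr_deriv ?_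
  have := phase_ne_zero E T n 0 s
  field_simp

theorem minGap_pos_and_le :
    0 < minGap E ∧ ∀ s ∈ Icc (0 : ℝ) 1, minGap E ≤ |E k s - E G s| := by
  -- Distinct energies force exactly one of the two labels to be `G`, so the infimum is that of a
  -- single continuous function on a compact interval, and is attained.
  have hset : {g | ∃ s ∈ Icc (0 : ℝ) 1, ∃ n m, E n s ≠ E m s ∧ g = |E n s - E m s|}
      = (fun s => |E k s - E G s|) '' Icc 0 1 := by
    ext g
    constructor
    · rintro ⟨s, hs, n, m, hnm, rfl⟩
      refine ⟨s, hs, ?_⟩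
      by_cases hn : n = G
      · have hm : m ≠ G := fun hm => hnm (by rw [hn, hm])
        simp only [hn, h.degenerate m hm hs, abs_sub_comm]
      · by_cases hm : m = G
        · simp only [hm, h.degenerate n hn hs]
        · exact absurd ((h.degenerate n hn hs).trans (h.degenerate m hm hs).symm) hnm
    · rintro ⟨s, hs, rfl⟩
      exact ⟨s, hs, k, G, h.gap s hs, rfl⟩
  have hcont : ContinuousOn (fun s => |E k s - E G s|) (Icc 0 1) :=
    ((h.continuousOn_energy k).sub (h.continuousOn_energy G)).abs
  have hcpt : IsCompact ((fun s => |E k s - E G s|) '' Icc 0 1) :=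
    isCompact_Icc.image_of_continuousOn hcont
  rw [minGap, hset]
  constructor
  · obtain ⟨s, hs, he⟩ := hcpt.sInf_mem ((nonempty_Icc.2 zero_le_one).image _)
    rw [← he]
    exact abs_pos.2 (sub_ne_zero.2 (h.gap s hs))
  · exact fun s hs => csInf_le hcpt.bddBelow ⟨s, hs, rfl⟩

theorem norm_gap_inv_le {s : ℝ} (hs : s ∈ Icc (0 : ℝ) 1) :
    ‖(E k s - E G s : ℂ)⁻¹‖ ≤ (minGap E)⁻¹ := by
  obtain ⟨h0, h1⟩ := h.minGap_pos_and_le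
  rw [norm_inv, ← Complex.ofReal_sub, Complex.norm_real]
  exact inv_anti₀ h0 (h1 s hs)

theorem norm_tunneling_le {s : ℝ} (hs : s ∈ Icc (0 : ℝ) 1) :
    ‖tunneling v G s‖ ≤ maxNorm (dot H) / minGap E := by
  have h0 := h.minGap_pos_and_le.1
  rw [h.tunneling_eq hs, norm_smul, div_eq_inv_mul]
  refine mul_le_mul (h.norm_gap_inv_le hs) ?_ (norm_nonneg _) (by positivity)
  refine (norm_excited_le (h.frame.orthonormal s hs) G _).trans ?_
  refine (ContinuousLinearMap.le_opNorm _ _).trans ?_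
  rw [h.norm_frame hs, mul_one]
  exact h.norm_dot_le hs

theorem exists_hasDerivWithinAt_gap {s : ℝ} (hs : s ∈ Icc (0 : ℝ) 1) :
    ∃ δ : ℂ, HasDerivWithinAt (fun t => (E k t - E G t : ℂ)) δ (Icc 0 1) s ∧
      ‖δ‖ ≤ 2 * maxNorm (dot H) := by
  refine ⟨_, (h.hasDerivWithinAt_energy hs k).ofReal_comp.sub
    (h.hasDerivWithinAt_energy hs G).ofReal_comp, ?_⟩
  have hb : ∀ n, |(inner ℂ (v n s) (dot H s (v n s))).re| ≤ maxNorm (dot H) := fun n => by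
    refine (Complex.abs_re_le_norm _).trans ((norm_inner_le_norm _ _).trans ?_)
    rw [h.norm_frame hs, one_mul]
    refine (ContinuousLinearMap.le_opNorm _ _).trans ?_
    rw [h.norm_frame hs, mul_one]
    exact h.norm_dot_le hs
  refine (norm_sub_le _ _).trans ?_
  rw [Complex.norm_real, Complex.norm_real, Real.norm_eq_abs, Real.norm_eq_abs]
  linarith [hb k, hb G]

theorem exists_hasDerivWithinAt_gap_inv {s : ℝ} (hs : s ∈ Icc (0 : ℝ) 1) :
    ∃ δ : ℂ, HasDerivWithinAt (fun t => (E k t - E G t : ℂ)⁻¹) δ (Icc 0 1) s ∧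
      ‖δ‖ ≤ 2 * maxNorm (dot H) / minGap E ^ 2 := by
  obtain ⟨δ, h1, h2⟩ := h.exists_hasDerivWithinAt_gap hs
  refine ⟨_, h1.fun_inv (h.gap_ne_zero hs), ?_⟩
  have h0 := h.minGap_pos_and_le.1
  have h3 := h.norm_gap_inv_le hs
  rw [norm_div, norm_neg, norm_pow, div_eq_mul_inv, div_eq_mul_inv, ← inv_pow, ← inv_pow,
    ← norm_inv]
  have h4 := (norm_nonneg _).trans h2
  gcongr

/-- Differentiate the formula of `tunneling_eq`. The coefficient `4` collects one contribution from
the moving frame, one from the derivative of the ground state, and two from the inverse gap. -/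
theorem exists_hasDerivWithinAt_tunneling {s : ℝ} (hs : s ∈ Icc (0 : ℝ) 1) :
    ∃ τ' : Ket N, HasDerivWithinAt (tunneling v G) τ' (Icc 0 1) s ∧
      ‖τ'‖ ≤ 4 * maxNorm (dot H) ^ 2 / minGap E ^ 2 + maxNorm (dot (dot H)) / minGap E := by
  obtain ⟨δ, hδ, hδn⟩ := h.exists_hasDerivWithinAt_gap_inv hs
  have h0 := h.minGap_pos_and_le.1
  have hx := hasDerivWithinAt_op_apply (hasDerivWithinAt_dot h.twiceDiff.2 hs)
    (h.frame.hasDerivWithinAt hs G)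
  have ho := h.frame.orthonormal s hs
  refine ⟨_, (hδ.smul (h.hasDerivWithinAt_excited hs hx)).congr_of_mem
    (fun t ht => h.tunneling_eq ht) hs, ?_⟩
  set h₁ := maxNorm (dot H)
  set h₂ := maxNorm (dot (dot H))
  set γ := minGap E
  have hop : ∀ x : Ket N, ‖dot H s x‖ ≤ h₁ * ‖x‖ := fun x =>
    (ContinuousLinearMap.le_opNorm _ _).trans (by gcongr; exact h.norm_dot_le hs)
  have hτ := h.norm_tunneling_le hs
  have hh₁ : 0 ≤ h₁ := (norm_nonneg _).trans (h.norm_dot_le hs)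
  have hG : ‖dot H s (v G s)‖ ≤ h₁ := by simpa [h.norm_frame hs] using hop (v G s)
  have e1 : ‖inner ℂ (v G s) (dot H s (v G s)) • tunneling v G s‖ ≤ h₁ * (h₁ / γ) := by
    rw [norm_smul]
    refine mul_le_mul ((norm_inner_le_norm _ _).trans ?_) hτ (norm_nonneg _) hh₁
    rwa [h.norm_frame hs, one_mul]
  have e2 : ‖excited v G s (dot (dot H) s (v G s) + dot H s (dot (v G) s))‖
      ≤ h₂ + h₁ * (h₁ / γ) := by
    refine (norm_excited_le ho G _).trans ((norm_add_le _ _).trans (add_le_add ?_ ?_))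
    · refine (ContinuousLinearMap.le_opNorm _ _).trans ?_
      rw [h.norm_frame hs, mul_one]
      exact h.norm_dot_dot_le hs
    · refine (hop _).trans ?_
      rw [h.norm_dot_ground hs]
      gcongr
  have e3 : ‖excited v G s (dot H s (v G s))‖ ≤ h₁ := (norm_excited_le ho G _).trans hG
  refine (norm_add_le _ _).trans ?_
  rw [norm_smul, norm_smul]
  have e4 := mul_le_mul (h.norm_gap_inv_le hs) ((norm_add_le _ _).trans (add_le_add e1 e2))
    (norm_nonneg _) (by positivity)
  have e5 := mul_le_mul hδn e3 (norm_nonneg _) (by positivity)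
  refine (add_le_add e4 e5).trans (le_of_eq ?_)
  change γ⁻¹ * _ + _ = _
  field_simp
  ring

theorem hasDerivWithinAt_phase_ratio (T : ℝ) {s : ℝ} (hs : s ∈ Icc (0 : ℝ) 1) :
    HasDerivWithinAt (fun t => (phase E T k 0 t)⁻¹ * phase E T G 0 t)
      (Complex.I * T * (E k s - E G s) * ((phase E T k 0 s)⁻¹ * phase E T G 0 s))
      (Icc 0 1) s :=
  ((h.hasDerivWithinAt_phase_inv T k hs).mul (h.hasDerivWithinAt_phase T G hs)).congr_deriv
    (by ring)

theorem continuousOn_oscillatingTunneling (T : ℝ) :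
    ContinuousOn (oscillatingTunneling E v T G k) (Icc 0 1) := fun s hs => by
  obtain ⟨τ', hτ, -⟩ := h.exists_hasDerivWithinAt_tunneling hs
  exact (h.hasDerivWithinAt_phase_ratio T hs).continuousWithinAt.smul hτ.continuousWithinAt

theorem norm_approxPrimitive_le {T : ℝ} (hT : 0 < T) {s : ℝ} (hs : s ∈ Icc (0 : ℝ) 1) :
    ‖approxPrimitive E v T G k s‖ ≤ maxNorm (dot H) / minGap E / (minGap E * T) := by
  have h0 := h.minGap_pos_and_le.1
  have e1 := mul_le_mul (h.norm_gap_inv_le hs) (h.norm_tunneling_le hs) (norm_nonneg _)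
    (by positivity)
  rw [approxPrimitive, norm_smul, norm_phase_ratio, one_mul, norm_smul, norm_smul, norm_inv,
    norm_mul, Complex.norm_I, one_mul, Complex.norm_real, Real.norm_of_nonneg hT.le]
  calc T⁻¹ * _ ≤ T⁻¹ * ((minGap E)⁻¹ * (maxNorm (dot H) / minGap E)) := by gcongr
    _ = _ := by field_simp

/-- Differentiating the phase produces `iT(E_k - E_G)`, which cancels the prefactors. What remains
differentiates only the slowly varying factor and keeps `1/T`; the `6` is `4` from the tunneling
vector plus `2` from the inverse gap. -/
theorem exists_hasDerivWithinAt_approxPrimitive {T : ℝ} (hT : 0 < T) {s : ℝ}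
    (hs : s ∈ Icc (0 : ℝ) 1) :
    ∃ R : Ket N, HasDerivWithinAt (approxPrimitive E v T G k)
        (oscillatingTunneling E v T G k s + R) (Icc 0 1) s ∧
      ‖R‖ ≤ (6 * maxNorm (dot H) ^ 2 / minGap E ^ 3
        + maxNorm (dot (dot H)) / minGap E ^ 2) / T := by
  obtain ⟨δ, hδ, hδn⟩ := h.exists_hasDerivWithinAt_gap_inv hs
  obtain ⟨τ', hτ, hτn⟩ := h.exists_hasDerivWithinAt_tunneling hs
  have h0 := h.minGap_pos_and_le.1
  refine ⟨((phase E T k 0 s)⁻¹ * phase E T G 0 s) •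
    ((Complex.I * T)⁻¹ • ((E k s - E G s : ℂ)⁻¹ • τ' + δ • tunneling v G s)), ?_, ?_⟩
  · refine ((h.hasDerivWithinAt_phase_ratio T hs).smul
      ((hδ.smul hτ).const_smul ((Complex.I * T)⁻¹ : ℂ))).congr_deriv ?_
    rw [add_comm]
    congr 1
    change _ • ((Complex.I * (T : ℂ))⁻¹ • ((E k s - E G s : ℂ)⁻¹ • tunneling v G s)) = _
    rw [smul_smul, smul_smul, oscillatingTunneling]
    congr 1
    have := h.gap_ne_zero hs
    have hTc : (T : ℂ) ≠ 0 := Complex.ofReal_ne_zero.2 hT.ne'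
    have := Complex.I_ne_zero
    field_simp
  · rw [norm_smul, norm_phase_ratio, one_mul, norm_smul, norm_inv,
      norm_mul, Complex.norm_I, one_mul, Complex.norm_real, Real.norm_of_nonneg hT.le,
      div_eq_inv_mul _ T]
    gcongr
    refine (norm_add_le _ _).trans ?_
    rw [norm_smul, norm_smul]
    refine (add_le_add (mul_le_mul (h.norm_gap_inv_le hs) hτn (norm_nonneg _) (by positivity))
      (mul_le_mul hδn (h.norm_tunneling_le hs) (norm_nonneg _)
        ((norm_nonneg _).trans hδn))).trans (le_of_eq ?_)
    field_simp
    ring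

/-! ### Schrödinger evolution in the interaction picture. -/

section Evolution

variable {T : ℝ} {U : ℝ → Op N} (hU : IsTimeEvolution H T U) {s : ℝ} (hs : s ∈ Icc (0 : ℝ) 1)
include hU hs

theorem norm_evolution (x : Ket N) : ‖U s x‖ = ‖x‖ := by
  have hd : ∀ t ∈ Icc (0 : ℝ) 1,
      HasDerivWithinAt (fun t => inner ℂ (U t x) (U t x) - inner ℂ x x) 0 (Icc 0 1) t :=
    fun t ht => by
    have h1 := hU.hasDerivWithinAt_apply ht x
    refine ((h1.inner ℂ h1).sub_const _).congr_deriv ?_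
    rw [inner_smul_right, inner_smul_left, h.inner_apply ht]
    simp
  have h1 := norm_le_of_hasDerivWithinAt (C := 0) hd (by simp) (by simp [hU.initial]) hs
  have h2 := sub_eq_zero.1 (norm_le_zero_iff.1 h1)
  rw [inner_self_eq_norm_sq_to_K, inner_self_eq_norm_sq_to_K] at h2
  have h3 : ‖U s x‖ ^ 2 = ‖x‖ ^ 2 := by exact_mod_cast h2
  exact (sq_eq_sq₀ (norm_nonneg _) (norm_nonneg _)).1 h3

theorem hasDerivWithinAt_groundAmplitude (x : Ket N) :
    HasDerivWithinAt (fun t => (phase E T G 0 t)⁻¹ * inner ℂ (v G t) (U t x))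
      ((phase E T G 0 s)⁻¹ * inner ℂ (dot (v G) s) (U s x)) (Icc 0 1) s := by
  refine ((h.hasDerivWithinAt_phase_inv T G hs).mul ((h.frame.hasDerivWithinAt hs G).inner ℂ
    (hU.hasDerivWithinAt_apply hs x))).congr_deriv ?_
  rw [inner_smul_right, h.inner_frame_apply hs]
  ring

/-- All excited labels share the energy of `k`, so a single scalar phase removes the dynamical term
from the whole vector. -/
theorem hasDerivWithinAt_excitedAmplitude (x : Ket N) :
    HasDerivWithinAt (fun t => (phase E T k 0 t)⁻¹ • excited v G t (U t x))
      (((phase E T G 0 s)⁻¹ * inner ℂ (v G s) (U s x)) • oscillatingTunneling E v T G k s)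
      (Icc 0 1) s := by
  refine ((h.hasDerivWithinAt_phase_inv T k hs).smul (h.hasDerivWithinAt_excited hs
    (hU.hasDerivWithinAt_apply hs x))).congr_deriv ?_
  rw [excited_smul, h.excited_hamiltonian hs, oscillatingTunneling]
  have := phase_ne_zero E T G 0 s
  have e : (phase E T G 0 s)⁻¹ * inner ℂ (v G s) (U s x) *
      ((phase E T k 0 s)⁻¹ * phase E T G 0 s)
      = (phase E T k 0 s)⁻¹ * inner ℂ (v G s) (U s x) := by field_simp
  conv_rhs => rw [smul_smul, e]
  module

end Evolution

/-- The deviation of the excited amplitudes in the interaction picture from first-order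
perturbation theory. -/
theorem norm_excited_sub_integral_le {T : ℝ} (hT : 0 < T) {U : ℝ → Op N}
    (hU : IsTimeEvolution H T U) :
    ‖(phase E T k 0 1)⁻¹ • excited v G 1 (U 1 (v G 0))
        - ∫ s in (0 : ℝ)..1, oscillatingTunneling E v T G k s‖
      ≤ Gam (maxNorm (dot H)) (maxNorm (dot (dot H))) (minGap E) / (maxNorm (dot H) * T)
        * (Real.exp (Gam (maxNorm (dot H)) (maxNorm (dot (dot H))) (minGap E) / (minGap E * T))
          - 1) := by
  have h0 := h.minGap_pos_and_le.1
  have hz : (0 : ℝ) ∈ Icc (0 : ℝ) 1 := left_mem_Icc.2 zero_le_one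
  have hh₁ : 0 ≤ maxNorm (dot H) := (norm_nonneg _).trans (h.norm_dot_le hz)
  have hh₂ : 0 ≤ maxNorm (dot (dot H)) := (norm_nonneg _).trans (h.norm_dot_dot_le hz)
  have hκ : 0 ≤ maxNorm (dot H) / minGap E := by positivity
  choose! R hR hRn using fun s (hs : s ∈ Icc (0 : ℝ) 1) =>
    h.exists_hasDerivWithinAt_approxPrimitive hT hs
  have hb := fun s (hs : s ∈ Icc (0 : ℝ) 1) =>
    h.hasDerivWithinAt_excitedAmplitude hU hs (v G 0)
  have hb0 : (phase E T k 0 0)⁻¹ • excited v G 0 (U 0 (v G 0)) = 0 := by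
    have : excited v G 0 (v G 0) = 0 := by
      ext n
      by_cases hn : n = G
      · simp [excited, hn]
      · simp [excited, hn, (h.frame.orthonormal 0 hz).2 hn]
    rw [hU.initial, one_apply_eq_self, this, smul_zero]
  -- Here `b` is the excited amplitude, `B` the oscillating tunneling vector, `A` its approximate
  -- primitive; `‖a‖ ≤ 1` comes from unitarity.
  have key := norm_second_order_le
    (d := fun t => (phase E T k 0 t)⁻¹ • excited v G t (U t (v G 0))
      - ∫ s in (0 : ℝ)..t, oscillatingTunneling E v T G k s) hκ
    (fun s hs => h.hasDerivWithinAt_groundAmplitude hU hs (v G 0)) hb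
    (fun s hs => ((hb s hs).sub (hasDerivWithinAt_integral
      (h.continuousOn_oscillatingTunneling T) hs)).congr_deriv (by rw [sub_smul, one_smul]))
    hR (fun s hs => by
      rw [norm_mul, norm_smul, norm_inv, norm_inv, norm_phase, norm_phase, inv_one, one_mul,
        one_mul, h.inner_dot_eq hs, norm_neg]
      exact (norm_inner_le_norm _ _).trans (by gcongr; exact h.norm_tunneling_le hs))
    (fun s hs => h.norm_approxPrimitive_le hT hs) hRn
    (fun s hs => by
      rw [norm_mul, norm_inv, norm_phase, inv_one, one_mul]
      refine (norm_inner_le_norm _ _).trans (le_of_eq ?_)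
      rw [h.norm_evolution hU hs, h.norm_frame hs, h.norm_frame hz, one_mul])
    (by
      rw [hU.initial, one_apply_eq_self, inner_self_eq_norm_sq_to_K, h.norm_frame hz]
      simp [phase])
    hb0 (by simp only [hb0]; simp)
  refine key.trans ?_
  exact second_order_le_gam hh₁ hh₂ h0 hT

/-! ### Path amplitudes and the adiabatic error. -/

/-- Jumps between excited states have zero amplitude, so a path from `G` contributes only if it
alternates between `G` and excited states. -/
theorem pathAmplitude_eq_zero_or (T : ℝ) : ∀ (q : ℕ) (ν : Fin (q + 1) → Fin N), ν 0 = G →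
    (∀ i : Fin q, ν i.succ ≠ ν i.castSucc) →
    (∀ x ∈ Icc (0 : ℝ) 1, pathAmplitude E v T q ν x = 0) ∨ (ν (Fin.last q) = G ↔ Even q)
  | 0, ν, h0, _ => Or.inr (by simpa using h0)
  | q + 1, ν, h0, hν => by
    have hlast : ν (Fin.last (q + 1)) ≠ ν (Fin.last q).castSucc := hν (Fin.last q)
    have hzero : (∀ s ∈ Icc (0 : ℝ) 1, beta v (ν (Fin.last (q + 1))) (ν (Fin.last q).castSucc) s *
        pathAmplitude E v T q (fun i => ν i.castSucc) s = 0) →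
        ∀ x ∈ Icc (0 : ℝ) 1, pathAmplitude E v T (q + 1) ν x = 0 := fun hz x hx => by
      refine intervalIntegral.integral_zero_ae (Filter.Eventually.of_forall fun s hs => ?_)
      rw [uIoc_of_le hx.1] at hs
      rw [mul_assoc, hz s ⟨hs.1.le, hs.2.trans hx.2⟩, mul_zero]
    rcases pathAmplitude_eq_zero_or T q (fun i => ν i.castSucc) h0
      (fun i => hν i.castSucc) with hz | hG
    · exact Or.inl (hzero fun s hs => by rw [hz s hs, mul_zero])
    · by_cases hq : ν (Fin.last q).castSucc = G
      · refine Or.inr (iff_of_false (hq ▸ hlast) ?_)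
        rw [Nat.even_add_one, not_not]
        exact hG.1 hq
      · by_cases hl : ν (Fin.last (q + 1)) = G
        · refine Or.inr (iff_of_true hl ?_)
          rw [Nat.even_add_one]
          exact fun he => hq (hG.2 he)
        · exact Or.inl (hzero fun s hs => by rw [h.beta_eq_zero hs hl hq, zero_mul])

theorem jumpContribution_even (T : ℝ) (m : ℕ) : jumpContribution E v T G (2 * m) = 0 := by
  refine Finset.sum_eq_zero fun ν hν => ?_
  obtain ⟨h0, hν, hl⟩ := (Finset.mem_filter.1 hν).2
  rcases h.pathAmplitude_eq_zero_or T _ ν h0 hν with hz | hG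
  · rw [hz 1 (right_mem_Icc.2 zero_le_one), zero_smul]
  · exact absurd (hG.2 (even_two_mul m)) hl

theorem pathAmplitude_one (T : ℝ) {n : Fin N} (hn : n ≠ G) :
    pathAmplitude E v T 1 ![G, n] 1
      = phase E T k 0 1 * (∫ s in (0 : ℝ)..1, oscillatingTunneling E v T G k s) n := by
  have hint : IntervalIntegrable (oscillatingTunneling E v T G k) MeasureTheory.volume 0 1 :=
    ContinuousOn.intervalIntegrable_of_Icc zero_le_one (h.continuousOn_oscillatingTunneling T)
  have h1 : ∫ s in (0 : ℝ)..1, oscillatingTunneling E v T G k s n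
      = (∫ s in (0 : ℝ)..1, oscillatingTunneling E v T G k s) n :=
    (EuclideanSpace.proj (𝕜 := ℂ) n).intervalIntegral_comp_comm hint
  rw [← h1, ← intervalIntegral.integral_const_mul]
  refine intervalIntegral.integral_congr fun s hs => ?_
  rw [uIcc_of_le zero_le_one] at hs
  have hk : ∀ a ∈ Icc (0 : ℝ) 1, ∀ b ∈ Icc (0 : ℝ) 1,
      IntervalIntegrable (E k) MeasureTheory.volume a b := fun a ha b hb =>
    ((h.continuousOn_energy k).mono (ordConnected_Icc.uIcc_subset ha hb)).intervalIntegrable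
  -- Splitting the phase at `s` pulls the total phase out of the integral and leaves the
  -- interaction-picture integrand.
  have hph : phase E T n s 1 = phase E T k 0 1 * (phase E T k 0 s)⁻¹ := by
    have e1 : ∫ ξ in s..1, E n ξ = ∫ ξ in s..1, E k ξ :=
      intervalIntegral.integral_congr fun x hx => by
        rw [uIcc_of_le hs.2] at hx
        exact h.degenerate n hn ⟨hs.1.trans hx.1, hx.2⟩
    have e2 := intervalIntegral.integral_add_adjacent_intervals
      (hk 0 (left_mem_Icc.2 zero_le_one) s hs) (hk s hs 1 (right_mem_Icc.2 zero_le_one))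
    rw [phase, phase, phase, ← Complex.exp_neg, ← Complex.exp_add, e1, ← e2]
    congr 1
    push_cast
    ring
  simp [pathAmplitude, oscillatingTunneling, tunneling]
  change phase E T n s 1 * beta v n G s * _ = _
  rw [hph]
  ring

theorem jumpContribution_one (T : ℝ) :
    jumpContribution E v T G 1 = ∑ n with n ≠ G, (phase E T k 0 1 *
      (∫ s in (0 : ℝ)..1, oscillatingTunneling E v T G k s) n) • v n 1 := by
  refine Finset.sum_nbij' (fun ν => ν 1) (fun n => ![G, n]) ?_ ?_ ?_ ?_ ?_
  · intro ν hν
    exact Finset.mem_filter.2 ⟨Finset.mem_univ _, (Finset.mem_filter.1 hν).2.2.2⟩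
  · intro n hn
    have hn := (Finset.mem_filter.1 hn).2
    refine Finset.mem_filter.2 ⟨Finset.mem_univ _, rfl, fun i => ?_, hn⟩
    rw [Subsingleton.elim i 0]
    exact hn
  · intro ν hν
    have hν := (Finset.mem_filter.1 hν).2.1
    ext i
    fin_cases i
    · simp [hν]
    · rfl
  · intro n _
    rfl
  · intro ν hν
    obtain ⟨h0, -, h1⟩ := (Finset.mem_filter.1 hν).2
    have he : ν = ![G, ν 1] := by
      ext i
      fin_cases i
      · simp [h0]
      · rfl
    change _ • v (ν 1) 1 = _
    rw [← h.pathAmplitude_one T (n := ν 1) h1, ← he]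

/-- In the orthonormal frame at time `1`, the coordinates of both vectors agree off `G` up to the
phase `phase E T k 0 1`. An inequality suffices, because the `G` coordinate on the right is simply
discarded. -/
theorem norm_adiabaticError_sub_le (T : ℝ) (U : ℝ → Op N) :
    ‖adiabaticError U v G - jumpContribution E v T G 1‖
      ≤ ‖(phase E T k 0 1)⁻¹ • excited v G 1 (U 1 (v G 0))
        - ∫ s in (0 : ℝ)..1, oscillatingTunneling E v T G k s‖ := by
  obtain ⟨b, hb⟩ :=
    exists_orthonormalBasis (h.frame.orthonormal 1 (right_mem_Icc.2 zero_le_one))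
  rw [h.jumpContribution_one T]
  generalize ∫ s in (0 : ℝ)..1, oscillatingTunneling E v T G k s = J
  generalize hψ : U 1 (v G 0) = ψ
  have herr : adiabaticError U v G = ∑ n with n ≠ G, inner ℂ (v n 1) ψ • v n 1 := by
    have h1 := b.sum_repr' ψ
    simp only [hb] at h1
    have h2 := Finset.sum_filter_add_sum_filter_not Finset.univ (fun n => n = G)
      (fun n => inner ℂ (v n 1) ψ • v n 1)
    rw [h1, Finset.filter_eq' Finset.univ G, if_pos (Finset.mem_univ G),
      Finset.sum_singleton] at h2
    rw [adiabaticError, hψ, sub_apply, one_apply_eq_self, InnerProductSpace.rankOne_apply]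
    nth_rw 1 [← h2]
    rw [add_sub_cancel_left]
  have hrepr : adiabaticError U v G - ∑ n with n ≠ G, (phase E T k 0 1 * J n) • v n 1
      = b.repr.symm (WithLp.toLp 2 fun n => if n = G then 0 else
        phase E T k 0 1 * ((phase E T k 0 1)⁻¹ • excited v G 1 ψ - J) n) := by
    rw [herr, ← Finset.sum_sub_distrib, ← b.sum_repr_symm, Finset.sum_filter]
    refine Finset.sum_congr rfl fun n _ => ?_
    have := phase_ne_zero E T k 0 1
    by_cases hn : n = G
    · simp [hn]
    · simp [hn, hb, excited, ← sub_smul, mul_sub, mul_inv_cancel_left₀ this]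
  rw [hrepr, LinearIsometryEquiv.norm_map, EuclideanSpace.norm_eq, EuclideanSpace.norm_eq]
  refine Real.sqrt_le_sqrt (Finset.sum_le_sum fun n _ => ?_)
  by_cases hn : n = G
  · simp [hn]
  · simp [hn, norm_phase]

end IsTwoLevel

end Adiabatic

theorem corollary3 {N : ℕ} (hN : 2 ≤ N)
    (H : ℝ → Adiabatic.Op N)
    (hsa : ∀ s ∈ Set.Icc (0 : ℝ) 1, IsSelfAdjoint (H s))
    (hdiff : Adiabatic.TwiceDifferentiable H)
    (hbdd : BddAbove ((fun s => ‖Adiabatic.dot (Adiabatic.dot H) s‖) '' Set.Icc 0 1))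
    (E : Fin N → ℝ → ℝ) (v : Fin N → ℝ → Adiabatic.Ket N)
    (hframe : Adiabatic.IsEigenframe H E v)
    (G : Fin N) (E₁ : ℝ → ℝ)
    (hexc : ∀ s ∈ Set.Icc (0 : ℝ) 1, ∀ n, n ≠ G → E n s = E₁ s)
    (hgap : ∀ s ∈ Set.Icc (0 : ℝ) 1, E G s ≠ E₁ s)
    (T : ℝ) (hT : 0 < T)
    (U : ℝ → Adiabatic.Op N) (hU : Adiabatic.IsTimeEvolution H T U)
    (h₁ h₂ γ Γ : ℝ)
    (hh₁ : h₁ = Adiabatic.maxNorm (Adiabatic.dot H))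
    (hh₂ : h₂ = Adiabatic.maxNorm (Adiabatic.dot (Adiabatic.dot H)))
    (hγ : γ = Adiabatic.minGap E)
    (hΓ : Γ = Adiabatic.Gam h₁ h₂ γ) :
    (∀ m : ℕ, Adiabatic.jumpContribution E v T G (2 * m) = 0) ∧
    ‖Adiabatic.adiabaticError U v G - Adiabatic.jumpContribution E v T G 1‖ ≤
      Γ / (h₁ * T) * (Real.exp (Γ / (γ * T)) - 1) := by
  have : Nontrivial (Fin N) := Fin.nontrivial_iff_two_le.2 hN
  obtain ⟨k, hk⟩ := exists_ne G
  have h : Adiabatic.IsTwoLevel H E v G k :=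
    { selfAdjoint := hsa
      twiceDiff := hdiff
      bdd := hbdd
      frame := hframe
      degenerate := fun n hn s hs => (hexc s hs n hn).trans (hexc s hs k hk).symm
      gap := fun s hs he => hgap s hs (he.symm.trans (hexc s hs k hk)) }
  subst hΓ hh₁ hh₂ hγ
  exact ⟨h.jumpContribution_even T,
    (h.norm_adiabaticError_sub_le T U).trans (h.norm_excited_sub_integral_le hT hU)⟩
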